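/- Let $\mathbb S^m$ be the space of real symmetric $m\times m$ matrices with $\langle Y,Z\rangle=\operatorname{tr}(YZ)$ and Frobenius norm $\|\cdot\|_F$, let $\mathbb S^m_+$ be its cone of positive semidefinite matrices, $P$ the metric projection onto $\mathbb S^m_+$, and $\mathcal L_Y(Z)=Y\circ Z=(YZ+ZY)/2$. Let $f:\mathbb R^n\to\mathbb R$ and $G:\mathbb R^n\to\mathbb S^m$ be twice continuously differentiable, and consider the nonlinear semidefinite program $$\text{(NSDP)}\qquad \min_x f(x)\quad\text{subject to } G(x)\in\mathbb S^m_+ .$$ A pair $(x,\Lambda)\in\mathbb R^n\times\mathbb S^m$ is a KKT pair ($\Lambda$ is a Lagrange multiplier associated with $x$) if $\nabla_x L(x,\Lambda)=0$, where $L(x,\Lambda)=f(x)-\langle G(x),\Lambda\rangle$, and $\Lambda\circ G(x)=0$, $G(x)\in\mathbb S^m_+$, $\Lambda\in\mathbb S^m_+$. Assume that (NSDP) has a global minimizer and that every feasible $x$ is nondegenerate, i.e. $\mathbb S^m=\operatorname{lin}\mathcal T_{\mathbb S^m_+}(G(x))+\operatorname{Im}\nabla G(x)$, where $\mathcal T_{\mathbb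 S^m_+}(G(x))$ is the tangent cone of $\mathbb S^m_+$ at $G(x)$ and $\operatorname{lin}$ denotes the lineality space. Fix $\zeta_1,\zeta_2>0$ and put $$r(x)=\tfrac12\|P(-G(x))\|_F^2,\qquad N(x)=\nabla G(x)\nabla G(x)^*+\zeta_1^2\mathcal L_{G(x)}^2+\zeta_2^2\,r(x)I,\qquad \Lambda(x)=N(x)^{-1}\nabla G(x)\nabla f(x)$$ ($N(x)$ is invertible for every $x$ under the nondegeneracy assumption), and for $c>0$ $$L_c(x,\Lambda)=f(x)+\frac1{2c}\left(\|P(\Lambda-cG(x))\|_F^2-\|\Lambda\|_F^2\right)+\|N(x)(\Lambda(x)-\Lambda)\|_F^2 .$$ Let $\{x^k\}\subset\mathbb R^n$, $\{\Lambda_k\}\subset\mathbb S^m$ and $\{c_k\}\subset(0,\infty)$ be sequences such that $c_k\to\infty$, $x^k\to\hat x$ and $\Lambda_k\to\hat\Lambda$ for some $(\hat x,\hat\Lambda)\in\mathbb R^n\times\mathbb S^m$, and $(x^k,\Lambda_k)$ is a global minimizer of $L_{c_k}$ over $\mathbb R^n\times\mathbb S^m$ for every $k$. Then there is $\hat k$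 such that for all $k\ge\hat k$, $x^k$ is a global minimizer of (NSDP) and $\Lambda_k$ is a Lagrange multiplier associated with $x^k$. -/

import Mathlib

noncomputable section

namespace NSDP

/-- The symmetric real `m × m` matrices, as a linear subspace of all matrices. -/
def symmetricSubmodule (m : ℕ) : Submodule ℝ (Matrix (Fin m) (Fin m) ℝ) where
  carrier := {A | A.IsSymm}
  zero_mem' := Matrix.isSymm_zero
  add_mem' := fun hA hB => Matrix.IsSymm.add hA hB
  smul_mem' := fun c _ hA => Matrix.IsSymm.smul hA c

/-- The space `𝕊^m` of real symmetric `m × m` matrices. -/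
def SymMat (m : ℕ) : Type := symmetricSubmodule m

namespace SymMat

variable {m : ℕ}

instance : AddCommGroup (SymMat m) := inferInstanceAs (AddCommGroup (symmetricSubmodule m))

instance : Module ℝ (SymMat m) := inferInstanceAs (Module ℝ (symmetricSubmodule m))

instance : FiniteDimensional ℝ (SymMat m) :=
  inferInstanceAs (FiniteDimensional ℝ (symmetricSubmodule m))

/-- The underlying matrix of an element of `𝕊^m`. -/
def toMatrix : SymMat m →ₗ[ℝ] Matrix (Fin m) (Fin m) ℝ := (symmetricSubmodule m).subtype

/-- A symmetric matrix, seen as an element of `𝕊^m`. -/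
def ofMatrix (A : Matrix (Fin m) (Fin m) ℝ) (hA : A.IsSymm) : SymMat m := ⟨A, hA⟩

@[simp] theorem toMatrix_ofMatrix (A : Matrix (Fin m) (Fin m) ℝ) (hA : A.IsSymm) :
    (ofMatrix A hA).toMatrix = A := rfl

theorem isSymm_toMatrix (A : SymMat m) : A.toMatrix.IsSymm := A.2

theorem toMatrix_injective :
    Function.Injective (toMatrix : SymMat m → Matrix (Fin m) (Fin m) ℝ) :=
  Subtype.val_injective

theorem conjTranspose_toMatrix (A : SymMat m) : A.toMatrix.conjTranspose = A.toMatrix := by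
  rw [Matrix.conjTranspose_eq_transpose_of_trivial, A.isSymm_toMatrix.eq]

/-- The trace inner product `⟨Y, Z⟩ = tr (Y Z)` on `𝕊^m`. -/
@[reducible]
def innerCore (m : ℕ) : InnerProductSpace.Core ℝ (SymMat m) where
  inner A B := (A.toMatrix * B.toMatrix).trace
  conj_inner_symm A B := by simp [Matrix.trace_mul_comm A.toMatrix]
  re_inner_nonneg A := by
    have h := (Matrix.posSemidef_conjTranspose_mul_self A.toMatrix).trace_nonneg
    rwa [conjTranspose_toMatrix] at h
  add_left A B C := by simp [add_mul]
  smul_left A B r := by simp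
  definite A h := by
    apply toMatrix_injective
    rw [map_zero, ← Matrix.trace_conjTranspose_mul_self_eq_zero_iff, conjTranspose_toMatrix]
    exact h

/-- The norm of `𝕊^m` is the Frobenius norm `‖Z‖_F = ⟨Z, Z⟩ ^ (1/2)`. -/
instance : NormedAddCommGroup (SymMat m) := (innerCore m).toNormedAddCommGroup

instance : InnerProductSpace ℝ (SymMat m) := InnerProductSpace.ofCore (innerCore m).toCore

instance : CompleteSpace (SymMat m) := FiniteDimensional.complete ℝ (SymMat m)

theorem inner_def (A B : SymMat m) : inner ℝ A B = (A.toMatrix * B.toMatrix).trace := rfl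

/-- The cone `𝕊^m_+` of positive semidefinite matrices. -/
def psdCone (m : ℕ) : Set (SymMat m) := {A | A.toMatrix.PosSemidef}

theorem psdCone_nonempty : (psdCone m).Nonempty :=
  ⟨0, by simpa [psdCone] using Matrix.PosSemidef.zero⟩

theorem convex_psdCone : Convex ℝ (psdCone m) := by
  intro A hA B hB a b ha hb _
  simp only [psdCone, Set.mem_ofPred_eq, map_add, map_smul] at *
  exact (hA.smul ha).add (hB.smul hb)

theorem isClosed_psdCone : IsClosed (psdCone m) := by
  have h : psdCone m =
      ⋂ v : Fin m → ℝ, {A : SymMat m | 0 ≤ star v ⬝ᵥ (A.toMatrix.mulVec v)} := by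
    ext A
    simp only [psdCone, Set.mem_ofPred_eq, Set.mem_iInter, Matrix.posSemidef_iff_dotProduct_mulVec]
    refine ⟨fun h => h.2, fun h => ⟨?_, h⟩⟩
    exact A.conjTranspose_toMatrix
  rw [h]
  refine isClosed_iInter fun v => ?_
  let q : SymMat m →ₗ[ℝ] ℝ :=
    { toFun := fun A => star v ⬝ᵥ (A.toMatrix.mulVec v)
      map_add' := fun A B => by simp [Matrix.add_mulVec]
      map_smul' := fun c A => by simp [Matrix.smul_mulVec] }
  exact isClosed_le continuous_const q.continuous_of_finiteDimensional

theorem exists_psdProj (Z : SymMat m) :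
    ∃ P ∈ psdCone m, ‖Z - P‖ = ⨅ W : psdCone m, ‖Z - W‖ :=
  exists_norm_eq_iInf_of_complete_convex psdCone_nonempty isClosed_psdCone.isComplete
    convex_psdCone Z

/-- The metric projection of `𝕊^m` onto `𝕊^m_+`: the (unique) nearest point of the cone. -/
def psdProj (Z : SymMat m) : SymMat m := Classical.choose (exists_psdProj Z)

theorem psdProj_mem (Z : SymMat m) : psdProj Z ∈ psdCone m :=
  (Classical.choose_spec (exists_psdProj Z)).1

theorem norm_sub_psdProj (Z : SymMat m) :
    ‖Z - psdProj Z‖ = ⨅ W : psdCone m, ‖Z - W‖ :=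
  (Classical.choose_spec (exists_psdProj Z)).2

/-- The Jordan product `Y ∘ Z = (Y Z + Z Y) / 2`. -/
def jordan (Y Z : SymMat m) : SymMat m :=
  ofMatrix ((1 / 2 : ℝ) • (Y.toMatrix * Z.toMatrix + Z.toMatrix * Y.toMatrix)) <| by
    simp [Matrix.IsSymm, Matrix.transpose_mul, Y.isSymm_toMatrix.eq, Z.isSymm_toMatrix.eq,
      add_comm]

/-- The operator `𝓛_Y : Z ↦ Y ∘ Z` on `𝕊^m`. -/
def jordanOp (Y : SymMat m) : SymMat m →L[ℝ] SymMat m :=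
  LinearMap.toContinuousLinearMap
    { toFun := jordan Y
      map_add' := fun A B => toMatrix_injective <| by
        simp [jordan, mul_add, add_mul]; abel
      map_smul' := fun c A => toMatrix_injective <| by
        simp [jordan, smul_comm c] }

@[simp] theorem jordanOp_apply (Y Z : SymMat m) : jordanOp Y Z = jordan Y Z := rfl

end SymMat

open SymMat

variable {n m : ℕ}

/-- The lineality space `C ∩ (-C)` of a convex cone `C`. -/
def lineality {E : Type*} [AddCommGroup E] (C : Set E) : Set E := {h | h ∈ C ∧ -h ∈ C}

/-- The feasible set `{x | G(x) ∈ 𝕊^m_+}`. -/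
def feasibleSet (G : EuclideanSpace ℝ (Fin n) → SymMat m) : Set (EuclideanSpace ℝ (Fin n)) :=
  {x | G x ∈ psdCone m}

/-- The set of global minimizers of `f(x)` subject to `G(x) ∈ 𝕊^m_+`. -/
def globalMinimizers (f : EuclideanSpace ℝ (Fin n) → ℝ) (G : EuclideanSpace ℝ (Fin n) → SymMat m) :
    Set (EuclideanSpace ℝ (Fin n)) :=
  {x | x ∈ feasibleSet G ∧ ∀ y ∈ feasibleSet G, f x ≤ f y}

/-- The Lagrangian `L(x, Λ) = f(x) - ⟨G(x), Λ⟩`. -/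
def lagrangian (f : EuclideanSpace ℝ (Fin n) → ℝ) (G : EuclideanSpace ℝ (Fin n) → SymMat m)
    (x : EuclideanSpace ℝ (Fin n)) (Λ : SymMat m) : ℝ :=
  f x - inner ℝ (G x) Λ

/-- `(x, Λ)` satisfies the KKT conditions; that is, `x` is a KKT point and `Λ` is an associated
Lagrange multiplier. -/
structure IsKKT (f : EuclideanSpace ℝ (Fin n) → ℝ) (G : EuclideanSpace ℝ (Fin n) → SymMat m)
    (x : EuclideanSpace ℝ (Fin n)) (Λ : SymMat m) : Prop where
  stationary : gradient (fun y => lagrangian f G y Λ) x = 0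
  complementary : jordan Λ (G x) = 0
  primal_feasible : G x ∈ psdCone m
  dual_feasible : Λ ∈ psdCone m

/-- `x` is nondegenerate: `𝕊^m = lin T(G(x)) + Im ∇G(x)`, where `T(G(x))` is the tangent cone of
`𝕊^m_+` at `G(x)`. -/
def IsNondegenerate (G : EuclideanSpace ℝ (Fin n) → SymMat m) (x : EuclideanSpace ℝ (Fin n)) :
    Prop :=
  ∀ Z : SymMat m, ∃ H ∈ lineality (posTangentConeAt (psdCone m) (G x)),
    ∃ v : EuclideanSpace ℝ (Fin n), Z = H + fderiv ℝ G x v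

/-- The residual function `r(x) = ‖P(-G(x))‖_F² / 2`. -/
def residual (G : EuclideanSpace ℝ (Fin n) → SymMat m) (x : EuclideanSpace ℝ (Fin n)) : ℝ :=
  1 / 2 * ‖psdProj (-G x)‖ ^ 2

/-- The operator `N(x) = ∇G(x) ∇G(x)* + ζ₁² 𝓛_{G(x)}² + ζ₂² r(x) I` on `𝕊^m`. -/
def opN (ζ₁ ζ₂ : ℝ) (G : EuclideanSpace ℝ (Fin n) → SymMat m) (x : EuclideanSpace ℝ (Fin n)) :
    SymMat m →L[ℝ] SymMat m :=
  (fderiv ℝ G x).comp (ContinuousLinearMap.adjoint (fderiv ℝ G x))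
    + ζ₁ ^ 2 • (jordanOp (G x)).comp (jordanOp (G x))
    + (ζ₂ ^ 2 * residual G x) • ContinuousLinearMap.id ℝ (SymMat m)

/-- The multiplier estimate `Λ(x) = N(x)⁻¹ ∇G(x) ∇f(x)`. If every feasible point is nondegenerate,
then `N(x)` is invertible for every `x`, and `Ring.inverse` is its inverse. -/
def multiplierEstimate (ζ₁ ζ₂ : ℝ) (f : EuclideanSpace ℝ (Fin n) → ℝ)
    (G : EuclideanSpace ℝ (Fin n) → SymMat m) (x : EuclideanSpace ℝ (Fin n)) : SymMat m :=
  Ring.inverse (opN ζ₁ ζ₂ G x) (fderiv ℝ G x (gradient f x))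

/-- The augmented Lagrangian
`L_c(x, Λ) = f(x) + (‖P(Λ - c G(x))‖_F² - ‖Λ‖_F²) / (2c) + ‖N(x)(Λ(x) - Λ)‖_F²`. -/
def augLagrangian (ζ₁ ζ₂ : ℝ) (f : EuclideanSpace ℝ (Fin n) → ℝ)
    (G : EuclideanSpace ℝ (Fin n) → SymMat m) (c : ℝ)
    (x : EuclideanSpace ℝ (Fin n)) (Λ : SymMat m) : ℝ :=
  f x + 1 / (2 * c) * (‖psdProj (Λ - c • G x)‖ ^ 2 - ‖Λ‖ ^ 2)
    + ‖opN ζ₁ ζ₂ G x (multiplierEstimate ζ₁ ζ₂ f G x - Λ)‖ ^ 2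

/-- The set of global minimizers of `L_c` over `ℝⁿ × 𝕊^m`. -/
def augGlobalMinimizers (ζ₁ ζ₂ : ℝ) (f : EuclideanSpace ℝ (Fin n) → ℝ)
    (G : EuclideanSpace ℝ (Fin n) → SymMat m) (c : ℝ) :
    Set (EuclideanSpace ℝ (Fin n) × SymMat m) :=
  {p | ∀ (y : EuclideanSpace ℝ (Fin n)) (M : SymMat m),
    augLagrangian ζ₁ ζ₂ f G c p.1 p.2 ≤ augLagrangian ζ₁ ζ₂ f G c y M}

end NSDP

end

noncomputable section

open Filter Topology NSDP NSDP.SymMat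
open scoped MatrixOrder Matrix

namespace NSDP

/-! ### Positive semidefinite matrices and the lineality space of the tangent cone -/

namespace SymMat

variable {m : ℕ}

/-! Write `A = P(Λ - c G(x))`, `Y = A - Λ`, `S = c⁻¹ A`, and let `R = ∇G ∇f - N Λ` be the argument
of the last penalty. For large `c` a minimizer of `L_c` has `Y = 0`. Stationarity in `Λ` reads `Y =
2c N R`; stationarity in `x` reads `∇f = ∇G* A - 2 T* R`, where `T` is the derivative of `R` in `x`.
Moreau's decomposition makes `A` and `A - Λ + c G` complementary, so `G ∘ A = -S ∘ Y`; it also gives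
`r ≤ ‖c⁻¹ Y‖² / 2`. Substituting, `N Y = R + 2 ∇G T* R - ζ₁² G ∘ (S ∘ Y) + ζ₂² r A`, and each term
on the right is `o(1) ‖Y‖`, because `R = (2c)⁻¹ N⁻¹ Y` and `S → 0`. As `N⁻¹` stays bounded near the
limit point, `‖Y‖ ≤ ε ‖Y‖` with `ε → 0`, whence `Y = 0` (`norm_psdProj_sub_le_of_isMin`).

Then `R = 0`, the stationarity conditions become KKT (`isKKT_of_psdProj_eq`), and `L_c` is `f` plus
a nonnegative term, while its minimum is at most the optimal value. The bound `S → 0` comes from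
this same upper bound on `L_c`; it makes the limit point feasible, where nondegeneracy makes `N`
invertible (`isUnit_opN`). -/

theorem mulVec_dotProduct_mulVec (M C : Matrix (Fin m) (Fin m) ℝ) (v : Fin m → ℝ) :
    (C *ᵥ v) ⬝ᵥ (M *ᵥ (C *ᵥ v)) = v ⬝ᵥ ((Cᵀ * M * C) *ᵥ v) := by
  rw [← Matrix.mulVec_mulVec, ← Matrix.mulVec_mulVec, Matrix.dotProduct_mulVec v Cᵀ,
    Matrix.vecMul_transpose]

theorem mul_eq_zero_of_trace_mul_mul_eq_zero {G C : Matrix (Fin m) (Fin m) ℝ}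
    (hG : G.PosSemidef) (h : (Cᵀ * G * C).trace = 0) : G * C = 0 := by
  have h1 : Cᵀ * G * C = 0 := by
    have := hG.conjTranspose_mul_mul_same C
    rw [Matrix.conjTranspose_eq_transpose_of_trivial] at this
    exact this.trace_eq_zero_iff.1 h
  refine Matrix.ext_of_mulVec_single fun i => ?_
  have h2 := (hG.dotProduct_mulVec_zero_iff (C *ᵥ Pi.single i 1)).1 (by
    rw [star_trivial, mulVec_dotProduct_mulVec, h1]
    simp)
  rw [← Matrix.mulVec_mulVec, h2, Matrix.zero_mulVec]

theorem exists_transpose_mul_self {A : Matrix (Fin m) (Fin m) ℝ} (hA : A.PosSemidef) :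
    ∃ C : Matrix (Fin m) (Fin m) ℝ, A = C * Cᵀ := by
  have h := hA.nonneg
  refine ⟨CFC.sqrt A, ?_⟩
  have h2 : (CFC.sqrt A)ᵀ = CFC.sqrt A := by
    have := (Matrix.nonneg_iff_posSemidef.1 (CFC.sqrt_nonneg A)).isHermitian.eq
    rwa [Matrix.conjTranspose_eq_transpose_of_trivial] at this
  rw [h2, CFC.sqrt_mul_sqrt_self A h]

theorem trace_mul_nonneg {A B : Matrix (Fin m) (Fin m) ℝ} (hA : A.PosSemidef)
    (hB : B.PosSemidef) : 0 ≤ (A * B).trace := by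
  obtain ⟨C, rfl⟩ := exists_transpose_mul_self hB
  have := (hA.conjTranspose_mul_mul_same C).trace_nonneg
  rw [Matrix.conjTranspose_eq_transpose_of_trivial, mul_assoc, Matrix.trace_mul_comm,
    mul_assoc] at this
  exact this

theorem mul_eq_zero_of_trace_mul_eq_zero {A B : Matrix (Fin m) (Fin m) ℝ}
    (hA : A.PosSemidef) (hB : B.PosSemidef) (h : (A * B).trace = 0) : A * B = 0 := by
  obtain ⟨C, rfl⟩ := exists_transpose_mul_self hB
  rw [← mul_assoc, mul_eq_zero_of_trace_mul_mul_eq_zero hA, zero_mul]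
  rw [mul_assoc, Matrix.trace_mul_comm, mul_assoc]
  exact h

theorem toMatrix_jordan (Y Z : SymMat m) : (jordan Y Z).toMatrix =
    (1 / 2 : ℝ) • (Y.toMatrix * Z.toMatrix + Z.toMatrix * Y.toMatrix) := rfl

theorem jordan_comm (Y Z : SymMat m) : jordan Y Z = jordan Z Y :=
  toMatrix_injective <| by simp [toMatrix_jordan, add_comm]

theorem inner_jordan_left (X Y Z : SymMat m) :
    inner ℝ (jordan X Y) Z = inner ℝ Y (jordan X Z) := by
  simp only [inner_def, toMatrix_jordan, smul_mul_assoc, mul_smul_comm, add_mul,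
    mul_add, Matrix.trace_smul, Matrix.trace_add]
  rw [mul_assoc, Matrix.trace_mul_comm, mul_assoc, mul_assoc, add_comm]

/-- Complementary positive semidefinite matrices have zero Jordan product. -/
theorem jordan_eq_zero_of_inner_eq_zero {A B : SymMat m} (hA : A ∈ psdCone m)
    (hB : B ∈ psdCone m) (h : inner ℝ A B = 0) : jordan A B = 0 := by
  have h1 : A.toMatrix * B.toMatrix = 0 := mul_eq_zero_of_trace_mul_eq_zero hA hB h
  have h2 : B.toMatrix * A.toMatrix = 0 :=
    mul_eq_zero_of_trace_mul_eq_zero hB hA (by rwa [Matrix.trace_mul_comm])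
  apply toMatrix_injective
  simp [toMatrix_jordan, h1, h2]

/-- Multiplying `G Y + Y G = 0` by `Y` and taking traces gives `tr (Y G Y) = 0`, and `Y G Y` is
positive semidefinite. -/
theorem mul_eq_zero_of_jordan_eq_zero {G Y : SymMat m} (hG : G ∈ psdCone m)
    (h : jordan G Y = 0) : G.toMatrix * Y.toMatrix = 0 := by
  have h1 : G.toMatrix * Y.toMatrix + Y.toMatrix * G.toMatrix = 0 := by
    have := congrArg toMatrix h
    rwa [toMatrix_jordan, map_zero, smul_eq_zero_iff_right (by norm_num)] at this
  apply mul_eq_zero_of_trace_mul_mul_eq_zero hG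
  have h2 := congrArg (fun M => (Y.toMatrix * M).trace) h1
  simp only [mul_add, mul_zero, Matrix.trace_zero, Matrix.trace_add] at h2
  rw [Y.isSymm_toMatrix.eq]
  have h3 : (Y.toMatrix * (Y.toMatrix * G.toMatrix)).trace =
      (Y.toMatrix * (G.toMatrix * Y.toMatrix)).trace := by
    rw [Matrix.trace_mul_comm, mul_assoc]
  rw [mul_assoc]
  linarith

theorem inner_nonneg_of_mem {A B : SymMat m} (hA : A ∈ psdCone m) (hB : B ∈ psdCone m) :
    0 ≤ inner ℝ A B := trace_mul_nonneg hA hB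

theorem smul_mem_psdCone {A : SymMat m} (hA : A ∈ psdCone m) {t : ℝ} (ht : 0 ≤ t) :
    t • A ∈ psdCone m := by
  simp only [psdCone, Set.mem_ofPred_eq, map_smul] at *
  exact hA.smul ht

/-- The quadratic form `A ↦ vᵀ A v`, as a linear form in `A`. -/
def quadForm (v : Fin m → ℝ) : SymMat m →L[ℝ] ℝ :=
  LinearMap.toContinuousLinearMap
    { toFun := fun A => v ⬝ᵥ (A.toMatrix.mulVec v)
      map_add' := fun A B => by simp [Matrix.add_mulVec]
      map_smul' := fun c A => by simp [Matrix.smul_mulVec] }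

theorem quadForm_apply (v : Fin m → ℝ) (A : SymMat m) :
    quadForm v A = v ⬝ᵥ (A.toMatrix.mulVec v) := rfl

theorem quadForm_nonneg (v : Fin m → ℝ) {A : SymMat m} (hA : A ∈ psdCone m) :
    0 ≤ quadForm v A := by
  have := Matrix.PosSemidef.dotProduct_mulVec_nonneg hA v
  simpa [quadForm_apply] using this

/-- Self-duality of the cone: rank-one matrices `v vᵀ` suffice as tests. -/
theorem mem_psdCone_of_inner_nonneg {B : SymMat m}
    (h : ∀ A ∈ psdCone m, 0 ≤ inner ℝ B A) : B ∈ psdCone m := by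
  refine Matrix.PosSemidef.of_dotProduct_mulVec_nonneg B.conjTranspose_toMatrix fun v => ?_
  have hs : (Matrix.vecMulVec v v).IsSymm := Matrix.transpose_vecMulVec v v
  have h1 := h (ofMatrix (Matrix.vecMulVec v v) hs)
    (by simpa [psdCone] using Matrix.posSemidef_vecMulVec_self_star v)
  rwa [inner_def, toMatrix_ofMatrix, Matrix.mul_vecMulVec, Matrix.trace_vecMulVec,
    dotProduct_comm] at h1

theorem quadForm_nonneg_of_mem_posTangentCone {G H : SymMat m} {v : Fin m → ℝ}
    (hH : H ∈ posTangentConeAt (psdCone m) G) (hv : G.toMatrix *ᵥ v = 0) :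
    0 ≤ quadForm v H := by
  obtain ⟨α, l, hl, c, d, -, hds, hcd⟩ := exists_fun_of_mem_tangentConeAt hH
  refine ge_of_tendsto (((quadForm v).continuous.tendsto H).comp hcd) ?_
  filter_upwards [hds] with i hi
  have h0 : quadForm v G = 0 := by rw [quadForm_apply, hv, dotProduct_zero]
  have h1 := quadForm_nonneg v hi
  rw [map_add, h0, zero_add] at h1
  have h2 : quadForm v (c i • d i) = (c i : ℝ) * quadForm v (d i) := by
    rw [NNReal.smul_def, map_smul, smul_eq_mul]
  simp only [Function.comp, h2]
  positivity

/-- The form of `H` vanishes on `ker G`, since both `H` and `-H` are tangent. As `G Y = 0`, the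
range of `Y` lies in `ker G`, so `Y H Y = 0`; then `Y H` is nilpotent and has trace zero. -/
theorem inner_eq_zero_of_mem_lineality {G H Y : SymMat m} (hG : G ∈ psdCone m)
    (hH : H ∈ lineality (posTangentConeAt (psdCone m) G)) (hY : jordan G Y = 0) :
    inner ℝ Y H = 0 := by
  have hGY := mul_eq_zero_of_jordan_eq_zero hG hY
  have hq : ∀ v, G.toMatrix *ᵥ v = 0 → quadForm v H = 0 := fun v hv => by
    have h1 := quadForm_nonneg_of_mem_posTangentCone hH.1 hv
    have h2 := quadForm_nonneg_of_mem_posTangentCone hH.2 hv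
    rw [map_neg] at h2
    linarith
  have hYHY : Y.toMatrix * H.toMatrix * Y.toMatrix = 0 := by
    -- The form vanishes identically; semidefiniteness is recorded only so that trace zero forces
    -- the matrix to be zero.
    have hp : (Y.toMatrix * H.toMatrix * Y.toMatrix).PosSemidef := by
      refine Matrix.PosSemidef.of_dotProduct_mulVec_nonneg ?_ fun v => ?_
      · rw [Matrix.IsHermitian, Matrix.conjTranspose_mul, Matrix.conjTranspose_mul,
          conjTranspose_toMatrix, conjTranspose_toMatrix, mul_assoc]
      · have := hq (Y.toMatrix *ᵥ v) (by rw [Matrix.mulVec_mulVec, hGY, Matrix.zero_mulVec])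
        rw [quadForm_apply] at this
        rw [mulVec_dotProduct_mulVec, Y.isSymm_toMatrix.eq] at this
        rw [star_trivial, this]
    rw [← hp.trace_eq_zero_iff]
    rw [Matrix.trace]
    refine Finset.sum_eq_zero fun i _ => ?_
    have := hq (Y.toMatrix *ᵥ Pi.single i 1)
      (by rw [Matrix.mulVec_mulVec, hGY, Matrix.zero_mulVec])
    rw [quadForm_apply] at this
    rw [mulVec_dotProduct_mulVec, Y.isSymm_toMatrix.eq] at this
    simpa using this
  rw [inner_def]
  have hn : IsNilpotent (Y.toMatrix * H.toMatrix) := ⟨2, by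
    rw [pow_two, ← mul_assoc, hYHY, zero_mul]⟩
  exact (Matrix.isNilpotent_trace_of_isNilpotent hn).eq_zero

/-! ### The metric projection -/

theorem inner_sub_psdProj_le (Z : SymMat m) {A : SymMat m} (hA : A ∈ psdCone m) :
    inner ℝ (Z - psdProj Z) (A - psdProj Z) ≤ 0 :=
  (norm_eq_iInf_iff_real_inner_le_zero convex_psdCone (psdProj_mem Z)).1 (norm_sub_psdProj Z) A hA

/-- The cone contains both `2 P(Z)` and `0`, so the variational inequality holds with both signs. -/
theorem inner_sub_psdProj_self (Z : SymMat m) : inner ℝ (Z - psdProj Z) (psdProj Z) = 0 := by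
  have h1 := inner_sub_psdProj_le Z (smul_mem_psdCone (psdProj_mem Z) (zero_le_two (α := ℝ)))
  have h2 := inner_sub_psdProj_le Z (smul_mem_psdCone (psdProj_mem Z) (le_refl (0 : ℝ)))
  rw [two_smul, add_sub_cancel_right] at h1
  rw [zero_smul, zero_sub, inner_neg_right] at h2
  linarith

theorem inner_psdProj_self (Z : SymMat m) : inner ℝ Z (psdProj Z) = ‖psdProj Z‖ ^ 2 := by
  have := inner_sub_psdProj_self Z
  rw [inner_sub_left, real_inner_self_eq_norm_sq] at this
  linarith

/-- Half of Moreau's decomposition, by self-duality of the cone. -/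
theorem psdProj_sub_mem (Z : SymMat m) : psdProj Z - Z ∈ psdCone m := by
  refine mem_psdCone_of_inner_nonneg fun A hA => ?_
  have h1 := inner_sub_psdProj_le Z hA
  have h2 := inner_sub_psdProj_self Z
  rw [inner_sub_right, h2] at h1
  rw [← neg_sub, inner_neg_left]
  linarith

theorem jordan_psdProj_sub (Z : SymMat m) : jordan (psdProj Z) (psdProj Z - Z) = 0 := by
  refine jordan_eq_zero_of_inner_eq_zero (psdProj_mem Z) (psdProj_sub_mem Z) ?_
  rw [← neg_sub, inner_neg_right, real_inner_comm, inner_sub_psdProj_self, neg_zero]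

theorem norm_psdProj_le (Z : SymMat m) {A : SymMat m} (hA : A ∈ psdCone m) :
    ‖psdProj Z‖ ≤ ‖Z + A‖ := by
  have h1 := inner_psdProj_self Z
  have h2 := inner_nonneg_of_mem hA (psdProj_mem Z)
  have h3 := real_inner_le_norm (Z + A) (psdProj Z)
  rw [inner_add_left] at h3
  by_contra! h
  have h4 := norm_nonneg (Z + A)
  nlinarith

theorem norm_psdProj_sub_le (Z W : SymMat m) : ‖psdProj Z - psdProj W‖ ≤ ‖Z - W‖ := by
  have h1 := inner_sub_psdProj_le Z (psdProj_mem W)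
  have h2 := inner_sub_psdProj_le W (psdProj_mem Z)
  have h3 := real_inner_le_norm (Z - W) (psdProj Z - psdProj W)
  have h4 : ‖psdProj Z - psdProj W‖ ^ 2 ≤ inner ℝ (Z - W) (psdProj Z - psdProj W) := by
    rw [← real_inner_self_eq_norm_sq]
    simp only [inner_sub_left, inner_sub_right] at *
    linarith
  by_contra! h
  have h5 := norm_nonneg (Z - W)
  nlinarith

theorem continuous_psdProj : Continuous (psdProj : SymMat m → SymMat m) :=
  (LipschitzWith.of_dist_le_mul (K := 1) fun Z W => by
    simpa [dist_eq_norm] using norm_psdProj_sub_le Z W).continuous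

/-- The function `Z ↦ ‖P(Z)‖_F² / 2`, which is differentiable with gradient `P`. -/
def halfSqProj (Z : SymMat m) : ℝ := 1 / 2 * ‖psdProj Z‖ ^ 2

/-- `halfSqProj Z` is the supremum of the left side over the cone, attained at `P(Z)`. This
variational form drives the differentiability proof. -/
theorem inner_sub_le_halfSqProj (Z : SymMat m) {A : SymMat m} (hA : A ∈ psdCone m) :
    inner ℝ Z A - 1 / 2 * ‖A‖ ^ 2 ≤ halfSqProj Z := by
  have h1 := inner_sub_psdProj_le Z hA
  have h2 := inner_sub_psdProj_self Z
  have h3 := norm_sub_sq_real (psdProj Z) A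
  rw [inner_sub_right, h2, inner_sub_left] at h1
  have := sq_nonneg ‖psdProj Z - A‖
  rw [halfSqProj]
  linarith

theorem hasFDerivAt_halfSqProj (Z : SymMat m) :
    HasFDerivAt halfSqProj (innerSL ℝ (psdProj Z)) Z := by
  rw [hasFDerivAt_iff_isLittleO]
  -- Inserting `P(Z)` and `P(W)` in the variational form traps the remainder between `0` and `⟪W -
  -- Z, P(W) - P(Z)⟫`, which is quadratic because `P` is nonexpansive.
  have hO : (fun W => halfSqProj W - halfSqProj Z - innerSL ℝ (psdProj Z) (W - Z)) =O[𝓝 Z]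
      fun W => ‖W - Z‖ ^ 2 := by
    refine Asymptotics.IsBigO.of_bound 1 (Eventually.of_forall fun W => ?_)
    have h1 := inner_sub_le_halfSqProj W (psdProj_mem Z)
    have h2 := inner_sub_le_halfSqProj Z (psdProj_mem W)
    have h3 := inner_psdProj_self Z
    have h4 := inner_psdProj_self W
    have h5 := (real_inner_le_norm (W - Z) (psdProj W - psdProj Z)).trans
      (mul_le_mul_of_nonneg_left (norm_psdProj_sub_le W Z) (norm_nonneg _))
    rw [innerSL_apply_apply, real_inner_comm]
    simp only [inner_sub_left, inner_sub_right] at *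
    rw [one_mul, Real.norm_eq_abs, norm_pow, norm_norm, abs_le]
    have h6 := sq_nonneg ‖W - Z‖
    simp only [halfSqProj] at *
    constructor <;> linarith
  exact hO.trans_isLittleO (Asymptotics.isLittleO_pow_sub_sub Z one_lt_two)

theorem contDiff_halfSqProj : ContDiff ℝ 1 (halfSqProj : SymMat m → ℝ) :=
  contDiff_one_iff_hasFDerivAt.2 ⟨fun Z => innerSL ℝ (psdProj Z),
    (innerSL ℝ).continuous.comp continuous_psdProj, hasFDerivAt_halfSqProj⟩

end SymMat

/-! ### The operator `N(x)` and its invertibility at feasible points -/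

open ContinuousLinearMap (adjoint adjoint_inner_left adjoint_inner_right)

variable {n m : ℕ} {ζ₁ ζ₂ : ℝ} {f : EuclideanSpace ℝ (Fin n) → ℝ}
  {G : EuclideanSpace ℝ (Fin n) → SymMat m}

theorem residual_nonneg (x : EuclideanSpace ℝ (Fin n)) : 0 ≤ residual G x := by
  rw [residual]; positivity

theorem opN_apply (x : EuclideanSpace ℝ (Fin n)) (Z : SymMat m) :
    opN ζ₁ ζ₂ G x Z = fderiv ℝ G x (adjoint (fderiv ℝ G x) Z)
      + ζ₁ ^ 2 • jordanOp (G x) (jordanOp (G x) Z) + (ζ₂ ^ 2 * residual G x) • Z := rfl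

theorem inner_opN_left (x : EuclideanSpace ℝ (Fin n)) (Z W : SymMat m) :
    inner ℝ (opN ζ₁ ζ₂ G x Z) W = inner ℝ Z (opN ζ₁ ζ₂ G x W) := by
  simp only [opN_apply, inner_add_left, inner_add_right, real_inner_smul_left,
    real_inner_smul_right, jordanOp_apply, inner_jordan_left]
  rw [← adjoint_inner_right (fderiv ℝ G x), ← adjoint_inner_left (fderiv ℝ G x)]

theorem inner_opN_self (x : EuclideanSpace ℝ (Fin n)) (Z : SymMat m) :
    inner ℝ (opN ζ₁ ζ₂ G x Z) Z = ‖adjoint (fderiv ℝ G x) Z‖ ^ 2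
      + ζ₁ ^ 2 * ‖jordan (G x) Z‖ ^ 2 + ζ₂ ^ 2 * residual G x * ‖Z‖ ^ 2 := by
  simp only [opN_apply, inner_add_left, real_inner_smul_left, jordanOp_apply, inner_jordan_left,
    real_inner_self_eq_norm_sq]
  rw [← adjoint_inner_right, real_inner_self_eq_norm_sq]

/-- The quadratic form of `N` is a sum of nonnegative terms, so a kernel element `Y` satisfies `∇G*
Y = 0` and `G ∘ Y = 0`. It is then orthogonal to the image of `∇G` and to the lineality space, which
together span everything. -/
theorem opN_injective (hζ₁ : 0 < ζ₁) {x : EuclideanSpace ℝ (Fin n)} (hx : x ∈ feasibleSet G)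
    (hnd : IsNondegenerate G x) : Function.Injective (opN ζ₁ ζ₂ G x) := by
  rw [injective_iff_map_eq_zero]
  intro Y hY
  have h := inner_opN_self (ζ₁ := ζ₁) (ζ₂ := ζ₂) (G := G) x Y
  rw [hY, inner_zero_left] at h
  have h3 : 0 ≤ ζ₂ ^ 2 * residual G x * ‖Y‖ ^ 2 := by
    have := residual_nonneg (G := G) x
    positivity
  have h2 : 0 ≤ ζ₁ ^ 2 * ‖jordan (G x) Y‖ ^ 2 := by positivity
  have h1 := sq_nonneg ‖adjoint (fderiv ℝ G x) Y‖
  have e1 : adjoint (fderiv ℝ G x) Y = 0 := by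
    rw [← norm_eq_zero, ← sq_eq_zero_iff]; linarith
  have e2 : jordan (G x) Y = 0 := by
    have : ζ₁ ^ 2 * ‖jordan (G x) Y‖ ^ 2 = 0 := by linarith
    simpa [hζ₁.ne'] using this
  obtain ⟨H, hH, v, hv⟩ := hnd Y
  have hYY : inner ℝ Y Y = 0 := by
    nth_rewrite 2 [hv]
    rw [inner_add_right, inner_eq_zero_of_mem_lineality hx hH e2, ← adjoint_inner_left, e1,
      inner_zero_left, add_zero]
  exact inner_self_eq_zero.1 hYY

theorem isUnit_opN (hζ₁ : 0 < ζ₁) {x : EuclideanSpace ℝ (Fin n)} (hx : x ∈ feasibleSet G)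
    (hnd : IsNondegenerate G x) : IsUnit (opN ζ₁ ζ₂ G x) := by
  have hi := opN_injective (ζ₂ := ζ₂) hζ₁ hx hnd
  have hs : Function.Surjective (opN ζ₁ ζ₂ G x) :=
    (LinearMap.injective_iff_surjective (f := (opN ζ₁ ζ₂ G x).toLinearMap)).1 hi
  rw [ContinuousLinearMap.isUnit_iff_bijective]
  exact ⟨hi, hs⟩

/-! ### Smoothness -/

/-- Lets conjugate-linear maps (the adjoint, the Riesz isomorphism) be treated as real-linear ones.
-/
theorem contDiff_of_map_add_of_map_smul {E F : Type*} [NormedAddCommGroup E] [NormedSpace ℝ E]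
    [FiniteDimensional ℝ E] [NormedAddCommGroup F] [NormedSpace ℝ F] (T : E → F)
    (hadd : ∀ a b, T (a + b) = T a + T b) (hsmul : ∀ (t : ℝ) a, T (t • a) = t • T a)
    {k : WithTop ℕ∞} : ContDiff ℝ k T :=
  (LinearMap.toContinuousLinearMap
    { toFun := T, map_add' := hadd, map_smul' := hsmul : E →ₗ[ℝ] F }).contDiff

theorem contDiff_gradient (hf : ContDiff ℝ 2 f) : ContDiff ℝ 1 (gradient f) :=
  (contDiff_of_map_add_of_map_smul (InnerProductSpace.toDual ℝ _).symm
    (fun a b => map_add _ a b) (fun c a => by simp)).comp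
    (hf.fderiv_right (m := 1) (by norm_num))

theorem contDiff_adjoint_fderiv (hG : ContDiff ℝ 2 G) :
    ContDiff ℝ 1 fun x => adjoint (fderiv ℝ G x) :=
  (contDiff_of_map_add_of_map_smul
    (fun L : EuclideanSpace ℝ (Fin n) →L[ℝ] SymMat m => adjoint L)
    (fun a b => map_add _ a b) (fun c a => by simp)).comp
    (hG.fderiv_right (m := 1) (by norm_num))

theorem contDiff_jordanOp : ContDiff ℝ 1 (jordanOp : SymMat m → SymMat m →L[ℝ] SymMat m) := by
  refine contDiff_of_map_add_of_map_smul _ (fun A B => ?_) (fun c A => ?_)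
  · ext1 Z
    simp only [jordanOp_apply, add_apply, jordan_comm _ Z]
    exact map_add (jordanOp Z) A B
  · ext1 Z
    simp only [jordanOp_apply, smul_apply, jordan_comm _ Z]
    exact map_smul (jordanOp Z) c A

theorem contDiff_opN (hG : ContDiff ℝ 2 G) : ContDiff ℝ 1 (opN ζ₁ ζ₂ G) := by
  have hG1 : ContDiff ℝ 1 G := hG.of_le (by norm_num)
  have hJ : ContDiff ℝ 1 fun x => jordanOp (G x) := contDiff_jordanOp.comp hG1
  have hr : ContDiff ℝ 1 (residual G) := contDiff_halfSqProj.comp hG1.neg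
  exact (((hG.fderiv_right (m := 1) (by norm_num)).clm_comp (contDiff_adjoint_fderiv hG)).add
    ((hJ.clm_comp hJ).const_smul (ζ₁ ^ 2))).add ((contDiff_const.mul hr).smul contDiff_const)

theorem eventually_isUnit_opN (hG : ContDiff ℝ 2 G) {x : EuclideanSpace ℝ (Fin n)}
    (hN : IsUnit (opN ζ₁ ζ₂ G x)) : ∀ᶠ y in 𝓝 x, IsUnit (opN ζ₁ ζ₂ G y) := by
  have h : ∀ᶠ N in 𝓝 (opN ζ₁ ζ₂ G x), IsUnit N := by
    obtain ⟨u, hu⟩ := hN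
    rw [← hu]
    exact Units.nhds (R := SymMat m →L[ℝ] SymMat m) u
  exact (contDiff_opN hG).continuous.continuousAt.eventually h

/-- The value `∇G(x) ∇f(x) - N(x) Λ` of `N(x) (Λ(x) - Λ)`. -/
def multiplierDefect (ζ₁ ζ₂ : ℝ) (f : EuclideanSpace ℝ (Fin n) → ℝ)
    (G : EuclideanSpace ℝ (Fin n) → SymMat m) (Λ : SymMat m) (x : EuclideanSpace ℝ (Fin n)) :
    SymMat m :=
  fderiv ℝ G x (gradient f x) - opN ζ₁ ζ₂ G x Λ

/-- Removes `N(x)⁻¹` from the penalty: what remains is `C¹` in `x` and affine in `Λ`. -/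
theorem opN_multiplierEstimate_sub {x : EuclideanSpace ℝ (Fin n)}
    (hN : IsUnit (opN ζ₁ ζ₂ G x)) (Λ : SymMat m) :
    opN ζ₁ ζ₂ G x (multiplierEstimate ζ₁ ζ₂ f G x - Λ) = multiplierDefect ζ₁ ζ₂ f G Λ x := by
  rw [map_sub, multiplierDefect, multiplierEstimate, ← mul_apply_eq_comp,
    Ring.mul_inverse_cancel _ hN, one_apply_eq_self]

theorem augLagrangian_eq {x : EuclideanSpace ℝ (Fin n)} (hN : IsUnit (opN ζ₁ ζ₂ G x))
    (c : ℝ) (Λ : SymMat m) :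
    augLagrangian ζ₁ ζ₂ f G c x Λ = f x + 1 / (2 * c) * (2 * halfSqProj (Λ - c • G x) - ‖Λ‖ ^ 2)
      + ‖multiplierDefect ζ₁ ζ₂ f G Λ x‖ ^ 2 := by
  rw [augLagrangian, opN_multiplierEstimate_sub hN, halfSqProj]
  ring

theorem contDiff_fderiv_gradient (hf : ContDiff ℝ 2 f) (hG : ContDiff ℝ 2 G) :
    ContDiff ℝ 1 fun x => fderiv ℝ G x (gradient f x) :=
  (hG.fderiv_right (m := 1) (by norm_num)).clm_apply (contDiff_gradient hf)

theorem contDiff_multiplierDefect (hf : ContDiff ℝ 2 f) (hG : ContDiff ℝ 2 G) (Λ : SymMat m) :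
    ContDiff ℝ 1 (multiplierDefect ζ₁ ζ₂ f G Λ) :=
  (contDiff_fderiv_gradient hf hG).sub ((contDiff_opN hG).clm_apply contDiff_const)

/-- Separates the dependence on `Λ`, which makes the derivative jointly continuous in `x` and `Λ`.
-/
theorem fderiv_multiplierDefect (hf : ContDiff ℝ 2 f) (hG : ContDiff ℝ 2 G) (Λ : SymMat m)
    (x : EuclideanSpace ℝ (Fin n)) :
    fderiv ℝ (multiplierDefect ζ₁ ζ₂ f G Λ) x = fderiv ℝ (fun y => fderiv ℝ G y (gradient f y)) x
      - (ContinuousLinearMap.apply ℝ (SymMat m) Λ).comp (fderiv ℝ (opN ζ₁ ζ₂ G) x) := by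
  have h1 := ((contDiff_fderiv_gradient hf hG).differentiable one_ne_zero x).hasFDerivAt
  have h2 := ((contDiff_opN (ζ₁ := ζ₁) (ζ₂ := ζ₂) hG).differentiable one_ne_zero x).hasFDerivAt
  exact (h1.sub ((ContinuousLinearMap.apply ℝ (SymMat m) Λ).hasFDerivAt.comp x h2)).fderiv

theorem tendsto_fderiv_multiplierDefect (hf : ContDiff ℝ 2 f) (hG : ContDiff ℝ 2 G)
    {x : ℕ → EuclideanSpace ℝ (Fin n)} {Λ : ℕ → SymMat m} {xhat : EuclideanSpace ℝ (Fin n)}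
    {Λhat : SymMat m} (hx : Tendsto x atTop (𝓝 xhat)) (hΛ : Tendsto Λ atTop (𝓝 Λhat)) :
    Tendsto (fun k => fderiv ℝ (multiplierDefect ζ₁ ζ₂ f G (Λ k)) (x k)) atTop
      (𝓝 (fderiv ℝ (multiplierDefect ζ₁ ζ₂ f G Λhat) xhat)) := by
  simp only [fderiv_multiplierDefect hf hG]
  have h1 := (((contDiff_fderiv_gradient hf hG).continuous_fderiv one_ne_zero).tendsto xhat).comp hx
  have h2 := (((contDiff_opN (ζ₁ := ζ₁) (ζ₂ := ζ₂) hG).continuous_fderiv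
    one_ne_zero).tendsto xhat).comp hx
  have h3 := ((ContinuousLinearMap.apply ℝ (SymMat m)).continuous.tendsto Λhat).comp hΛ
  exact h1.sub (((isBoundedBilinearMap_comp (𝕜 := ℝ)).continuous.tendsto _).comp (h3.prodMk_nhds h2))

/-! ### First-order conditions -/

/-- Stationarity of `L_c` in `Λ`, using that `N(x)` is self-adjoint. -/
theorem psdProj_sub_eq_of_isMin {c : ℝ} (hc : 0 < c) {x : EuclideanSpace ℝ (Fin n)} {Λ : SymMat m}
    (hN : IsUnit (opN ζ₁ ζ₂ G x))
    (hmin : ∀ M, augLagrangian ζ₁ ζ₂ f G c x Λ ≤ augLagrangian ζ₁ ζ₂ f G c x M) :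
    psdProj (Λ - c • G x) - Λ =
      (2 * c) • opN ζ₁ ζ₂ G x (multiplierDefect ζ₁ ζ₂ f G Λ x) := by
  have h1 : HasFDerivAt (fun M : SymMat m => halfSqProj (M - c • G x))
      (innerSL ℝ (psdProj (Λ - c • G x))) Λ := by
    have := (hasFDerivAt_halfSqProj (Λ - c • G x)).comp Λ ((hasFDerivAt_id Λ).sub_const (c • G x))
    exact this
  have h2 : HasFDerivAt (fun M : SymMat m => ‖M‖ ^ 2) (2 • innerSL ℝ Λ) Λ :=
    (hasStrictFDerivAt_norm_sq Λ).hasFDerivAt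
  have h3 : HasFDerivAt (fun M => multiplierDefect ζ₁ ζ₂ f G M x) (-(opN ζ₁ ζ₂ G x)) Λ := by
    have := (opN ζ₁ ζ₂ G x).hasFDerivAt (x := Λ) |>.const_sub (fderiv ℝ G x (gradient f x))
    exact this
  have h4 := (((h1.const_mul 2).sub h2).const_mul (1 / (2 * c)) |>.const_add (f x)).add h3.norm_sq
  have h5 : IsLocalMin (fun M => f x + 1 / (2 * c) * (2 * halfSqProj (M - c • G x) - ‖M‖ ^ 2)
      + ‖multiplierDefect ζ₁ ζ₂ f G M x‖ ^ 2) Λ := Eventually.of_forall fun M => by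
    simpa only [augLagrangian_eq hN] using hmin M
  have h6 := h5.hasFDerivAt_eq_zero h4
  refine ext_inner_right ℝ fun Z => ?_
  have h7 := congrArg (fun L => L Z) h6
  simp at h7
  rw [← inner_opN_left] at h7
  rw [inner_sub_left, real_inner_smul_left]
  field_simp at h7
  linarith

theorem gradient_eq_of_isMin (hf : ContDiff ℝ 2 f) (hG : ContDiff ℝ 2 G)
    {c : ℝ} (hc : 0 < c) {x : EuclideanSpace ℝ (Fin n)} {Λ : SymMat m}
    (hN : IsUnit (opN ζ₁ ζ₂ G x))
    (hmin : ∀ y, augLagrangian ζ₁ ζ₂ f G c x Λ ≤ augLagrangian ζ₁ ζ₂ f G c y Λ) :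
    gradient f x = adjoint (fderiv ℝ G x) (psdProj (Λ - c • G x))
      - (2 : ℝ) • adjoint (fderiv ℝ (multiplierDefect ζ₁ ζ₂ f G Λ) x)
          (multiplierDefect ζ₁ ζ₂ f G Λ x) := by
  have h0 := (hf.differentiable two_ne_zero x).hasFDerivAt
  have hG' := (hG.differentiable two_ne_zero x).hasFDerivAt
  have h1 : HasFDerivAt (fun y => halfSqProj (Λ - c • G y))
      ((innerSL ℝ (psdProj (Λ - c • G x))).comp (-(c • fderiv ℝ G x))) x := by
    have h2 : HasFDerivAt (fun y => Λ - c • G y) (-(c • fderiv ℝ G x)) x :=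
      (hG'.const_smul c).const_sub Λ
    exact (hasFDerivAt_halfSqProj (Λ - c • G x)).comp x h2
  have h3 := ((contDiff_multiplierDefect (ζ₁ := ζ₁) (ζ₂ := ζ₂) hf hG Λ).differentiable
    one_ne_zero x).hasFDerivAt
  have h4 := (h0.add (((h1.const_mul 2).sub_const (‖Λ‖ ^ 2)).const_mul (1 / (2 * c)))).add
    h3.norm_sq
  -- The smooth formula for `L_c` is available only where `N(y)` is invertible, so only a local
  -- minimum is claimed.
  have hNev := eventually_isUnit_opN hG hN
  have h5 : IsLocalMin (fun y => f y + 1 / (2 * c) * (2 * halfSqProj (Λ - c • G y) - ‖Λ‖ ^ 2)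
      + ‖multiplierDefect ζ₁ ζ₂ f G Λ y‖ ^ 2) x := by
    filter_upwards [hNev] with y hy
    have := hmin y
    rwa [augLagrangian_eq hN, augLagrangian_eq hy] at this
  have h6 := h5.hasFDerivAt_eq_zero h4
  refine ext_inner_right ℝ fun v => ?_
  have h7 := congrArg (fun L => L v) h6
  simp at h7
  rw [gradient, InnerProductSpace.toDual_symm_apply, inner_sub_left, real_inner_smul_left,
    adjoint_inner_left, adjoint_inner_left]
  field_simp at h7
  linarith

/-- The choice `M = Λ(x)` kills the last penalty, and subtracting the semidefinite `c G(x)` cannot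
raise the norm of the projection above `‖M‖`. -/
theorem augLagrangian_multiplierEstimate_le {c : ℝ} (hc : 0 < c) {x : EuclideanSpace ℝ (Fin n)}
    (hx : x ∈ feasibleSet G) :
    augLagrangian ζ₁ ζ₂ f G c x (multiplierEstimate ζ₁ ζ₂ f G x) ≤ f x := by
  set M := multiplierEstimate ζ₁ ζ₂ f G x with hM
  have h1 : ‖psdProj (M - c • G x)‖ ≤ ‖M‖ := by
    simpa using norm_psdProj_le (M - c • G x) (smul_mem_psdCone hx hc.le)
  have h2 : ‖psdProj (M - c • G x)‖ ^ 2 - ‖M‖ ^ 2 ≤ 0 := by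
    have := pow_le_pow_left₀ (norm_nonneg _) h1 2
    linarith
  have h3 : 1 / (2 * c) * (‖psdProj (M - c • G x)‖ ^ 2 - ‖M‖ ^ 2) ≤ 0 :=
    mul_nonpos_of_nonneg_of_nonpos (by positivity) h2
  rw [augLagrangian, ← hM, sub_self, map_zero, norm_zero]
  linarith

/-- Adding the semidefinite matrix `c⁻¹ (A - (Λ - c G))` to `-G` gives `c⁻¹ (A - Λ)`, whose norm
bounds that of `P(-G)`. -/
theorem residual_le {c : ℝ} (hc : 0 < c) (x : EuclideanSpace ℝ (Fin n)) (Λ : SymMat m) :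
    residual G x ≤ 1 / 2 * ‖c⁻¹ • (psdProj (Λ - c • G x) - Λ)‖ ^ 2 := by
  have h1 := norm_psdProj_le (-G x) (smul_mem_psdCone (psdProj_sub_mem (Λ - c • G x))
    (inv_nonneg.2 hc.le))
  have h2 : -G x + c⁻¹ • (psdProj (Λ - c • G x) - (Λ - c • G x)) =
      c⁻¹ • (psdProj (Λ - c • G x) - Λ) := by
    rw [← sub_add, smul_add, inv_smul_smul₀ hc.ne']
    abel
  rw [h2] at h1
  rw [residual]
  have := pow_le_pow_left₀ (norm_nonneg _) h1 2
  linarith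

theorem jordan_psdProj_eq {c : ℝ} (hc : 0 < c) (Z Λ : SymMat m) :
    jordanOp Z (psdProj (Λ - c • Z)) =
      -jordanOp (c⁻¹ • psdProj (Λ - c • Z)) (psdProj (Λ - c • Z) - Λ) := by
  set A := psdProj (Λ - c • Z) with hA
  have h1 : jordanOp A (A - Λ + c • Z) = 0 := by
    have := jordan_psdProj_sub (Λ - c • Z)
    rwa [← hA, ← sub_add] at this
  rw [map_add, map_smul] at h1
  have h2 : jordanOp (c⁻¹ • A) (A - Λ) = c⁻¹ • jordanOp A (A - Λ) := by
    rw [jordanOp_apply, jordan_comm, ← jordanOp_apply, map_smul, jordanOp_apply, jordan_comm,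
      ← jordanOp_apply]
  rw [h2, eq_neg_of_add_eq_zero_left h1, smul_neg, inv_smul_smul₀ hc.ne', neg_neg,
    jordanOp_apply, jordan_comm, jordanOp_apply]

/-- At a minimizer of `L_c`, the distance from `Λ` to `P(Λ - c G(x))` is controlled by itself, with
a factor that is small for large `c`. -/
theorem norm_psdProj_sub_le_of_isMin (hf : ContDiff ℝ 2 f) (hG : ContDiff ℝ 2 G)
    {c : ℝ} (hc : 0 < c) {x : EuclideanSpace ℝ (Fin n)} {Λ : SymMat m}
    (hN : IsUnit (opN ζ₁ ζ₂ G x)) (hmin : (x, Λ) ∈ augGlobalMinimizers ζ₁ ζ₂ f G c)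
    {A Y S : SymMat m} (hA : A = psdProj (Λ - c • G x)) (hY : Y = A - Λ) (hS : S = c⁻¹ • A) :
    ‖Y‖ ≤ ‖Ring.inverse (opN ζ₁ ζ₂ G x)‖ *
      (1 / 2 * c⁻¹ * ‖Ring.inverse (opN ζ₁ ζ₂ G x)‖ *
          (1 + 2 * (‖fderiv ℝ G x‖ * ‖fderiv ℝ (multiplierDefect ζ₁ ζ₂ f G Λ) x‖))
        + ζ₁ ^ 2 * (‖jordanOp (G x)‖ * ‖jordanOp S‖)
        + ζ₂ ^ 2 * (1 / 2 * (‖c⁻¹ • Y‖ * ‖S‖))) * ‖Y‖ := by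
  set N := opN ζ₁ ζ₂ G x with hNdef
  set R := multiplierDefect ζ₁ ζ₂ f G Λ x with hR
  set T := fderiv ℝ (multiplierDefect ζ₁ ζ₂ f G Λ) x with hT
  have hinv : ∀ Z, Z = Ring.inverse N (N Z) := fun Z => by
    rw [← mul_apply_eq_comp, Ring.inverse_mul_cancel _ hN, one_apply_eq_self]
  have hYR : Y = (2 * c) • N R := by
    rw [hY, hA]
    exact psdProj_sub_eq_of_isMin hc hN fun M => hmin x M
  have hgrad := gradient_eq_of_isMin hf hG hc hN fun y => hmin y Λ
  rw [← hA, ← hT, ← hR] at hgrad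
  have hRnorm : ‖R‖ ≤ 1 / 2 * c⁻¹ * ‖Ring.inverse N‖ * ‖Y‖ := by
    have h1 : R = (1 / 2 * c⁻¹) • Ring.inverse N Y := by
      rw [hYR, map_smul, ← hinv R, smul_smul]
      field_simp
      rw [one_smul]
    nth_rewrite 1 [h1]
    rw [norm_smul, Real.norm_of_nonneg (by positivity), mul_assoc _ ‖Ring.inverse N‖]
    gcongr
    exact ContinuousLinearMap.le_opNorm _ _
  -- Expand `N A - N Λ`: `N Λ = ∇G ∇f - R`, and stationarity in `x` cancels `∇G ∇G* A` against `∇G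
  -- ∇f`.
  have hNY : N Y = (R + (2 : ℝ) • fderiv ℝ G x (adjoint T R))
      + ζ₁ ^ 2 • (-jordanOp (G x) (jordanOp S Y)) + (ζ₂ ^ 2 * residual G x) • A := by
    have h1 : jordanOp (G x) A = -jordanOp S Y := by
      rw [hY, hS, hA]
      exact jordan_psdProj_eq hc (G x) Λ
    have h2 : R = fderiv ℝ G x (gradient f x) - N Λ := rfl
    rw [← map_neg, ← h1]
    nth_rewrite 1 [h2]
    rw [hgrad, hY, map_sub, map_sub, map_smul]
    rw [hNdef, opN_apply x A]
    abel
  have hJ : ‖jordanOp (G x) (jordanOp S Y)‖ ≤ ‖jordanOp (G x)‖ * ‖jordanOp S‖ * ‖Y‖ := by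
    rw [mul_assoc]
    exact ContinuousLinearMap.le_opNorm_of_le _ (ContinuousLinearMap.le_opNorm _ _)
  have hD : ‖fderiv ℝ G x (adjoint T R)‖ ≤ ‖fderiv ℝ G x‖ * ‖T‖ * ‖R‖ := by
    rw [mul_assoc, ← LinearIsometryEquiv.norm_map adjoint T]
    exact ContinuousLinearMap.le_opNorm_of_le _ (ContinuousLinearMap.le_opNorm _ _)
  have hr : ‖(ζ₂ ^ 2 * residual G x) • A‖ ≤ ζ₂ ^ 2 * (1 / 2 * (‖c⁻¹ • Y‖ * ‖S‖)) * ‖Y‖ := by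
    have h1 := residual_le (G := G) hc x Λ
    rw [← hA, ← hY] at h1
    rw [norm_smul, Real.norm_of_nonneg (mul_nonneg (sq_nonneg _) (residual_nonneg x))]
    have h2 : ‖S‖ = c⁻¹ * ‖A‖ := by
      rw [hS, norm_smul, Real.norm_of_nonneg (inv_nonneg.2 hc.le)]
    have h3 : ‖c⁻¹ • Y‖ = c⁻¹ * ‖Y‖ := by
      rw [norm_smul, Real.norm_of_nonneg (inv_nonneg.2 hc.le)]
    -- One factor `c⁻¹` moves from `‖c⁻¹ Y‖²` to `A`, leaving the small factors `‖c⁻¹ Y‖` and `‖S‖`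
    -- times `‖Y‖`.
    calc ζ₂ ^ 2 * residual G x * ‖A‖ ≤ ζ₂ ^ 2 * (1 / 2 * ‖c⁻¹ • Y‖ ^ 2) * ‖A‖ := by gcongr
      _ = ζ₂ ^ 2 * (1 / 2 * (‖c⁻¹ • Y‖ * ‖S‖)) * ‖Y‖ := by rw [h2, h3]; ring
  have hNYnorm : ‖N Y‖ ≤ ‖R‖ * (1 + 2 * (‖fderiv ℝ G x‖ * ‖T‖))
      + ζ₁ ^ 2 * (‖jordanOp (G x)‖ * ‖jordanOp S‖) * ‖Y‖
      + ζ₂ ^ 2 * (1 / 2 * (‖c⁻¹ • Y‖ * ‖S‖)) * ‖Y‖ := by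
    rw [hNY]
    refine (norm_add₃_le).trans (add_le_add_three ?_ ?_ hr)
    · refine (norm_add_le _ _).trans ?_
      rw [norm_smul, Real.norm_of_nonneg zero_le_two]
      linarith
    · rw [norm_smul, norm_neg, Real.norm_of_nonneg (sq_nonneg _), mul_assoc]
      exact mul_le_mul_of_nonneg_left hJ (sq_nonneg _)
  calc ‖Y‖ = ‖Ring.inverse N (N Y)‖ := by rw [← hinv Y]
    _ ≤ ‖Ring.inverse N‖ * ‖N Y‖ := ContinuousLinearMap.le_opNorm _ _
    _ ≤ ‖Ring.inverse N‖ * ((1 / 2 * c⁻¹ * ‖Ring.inverse N‖ * ‖Y‖)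
            * (1 + 2 * (‖fderiv ℝ G x‖ * ‖T‖))
          + ζ₁ ^ 2 * (‖jordanOp (G x)‖ * ‖jordanOp S‖) * ‖Y‖
          + ζ₂ ^ 2 * (1 / 2 * (‖c⁻¹ • Y‖ * ‖S‖)) * ‖Y‖) := by
        refine mul_le_mul_of_nonneg_left (hNYnorm.trans ?_)
          (norm_nonneg (E := SymMat m →L[ℝ] SymMat m) _)
        gcongr
    _ = _ := by ring

theorem gradient_lagrangian (hf : ContDiff ℝ 2 f) (hG : ContDiff ℝ 2 G)
    (x : EuclideanSpace ℝ (Fin n)) (Λ : SymMat m) :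
    gradient (fun y => lagrangian f G y Λ) x = gradient f x - adjoint (fderiv ℝ G x) Λ := by
  have h1 := (hf.differentiable two_ne_zero x).hasFDerivAt
  have h2 := (hG.differentiable two_ne_zero x).hasFDerivAt
  have h3 := h1.sub (h2.inner ℝ (hasFDerivAt_const Λ x))
  have h4 : fderiv ℝ (fun y => lagrangian f G y Λ) x = _ := h3.fderiv
  refine ext_inner_right ℝ fun v => ?_
  rw [inner_sub_left, adjoint_inner_left, gradient, gradient,
    InnerProductSpace.toDual_symm_apply, InnerProductSpace.toDual_symm_apply, h4]
  simp [real_inner_comm]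

theorem isKKT_of_psdProj_eq (hf : ContDiff ℝ 2 f) (hG : ContDiff ℝ 2 G)
    {c : ℝ} (hc : 0 < c) {x : EuclideanSpace ℝ (Fin n)} {Λ : SymMat m}
    (hN : IsUnit (opN ζ₁ ζ₂ G x)) (hmin : (x, Λ) ∈ augGlobalMinimizers ζ₁ ζ₂ f G c)
    (hΛ : psdProj (Λ - c • G x) = Λ) : IsKKT f G x Λ := by
  have hR : multiplierDefect ζ₁ ζ₂ f G Λ x = 0 := by
    have h1 := psdProj_sub_eq_of_isMin hc hN fun M => hmin x M
    rw [hΛ, sub_self, eq_comm, smul_eq_zero_iff_right (by positivity)] at h1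
    exact (ContinuousLinearMap.isUnit_iff_bijective.1 hN).1 (by rw [h1, map_zero])
  refine ⟨?_, ?_, ?_, ?_⟩
  · have h1 := gradient_eq_of_isMin hf hG hc hN fun y => hmin y Λ
    rw [hΛ, hR, map_zero, smul_zero, sub_zero] at h1
    rw [gradient_lagrangian hf hG, h1, sub_self]
  · have h1 := jordan_psdProj_sub (Λ - c • G x)
    rw [hΛ, sub_sub_cancel, ← jordanOp_apply, map_smul,
      smul_eq_zero_iff_right hc.ne'] at h1
    exact h1
  · have h1 := psdProj_sub_mem (Λ - c • G x)
    rw [hΛ, sub_sub_cancel] at h1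
    have h2 := smul_mem_psdCone h1 (inv_nonneg.2 hc.le)
    rwa [inv_smul_smul₀ hc.ne'] at h2
  · rw [← hΛ]
    exact psdProj_mem _

/-! ### Limits as the penalty parameter tends to infinity -/

theorem tendsto_inv_smul_psdProj (hf : Continuous f)
    {x : ℕ → EuclideanSpace ℝ (Fin n)} {Λ : ℕ → SymMat m} {c : ℕ → ℝ}
    {xhat : EuclideanSpace ℝ (Fin n)} {Λhat : SymMat m} {b : ℝ}
    (hx : Tendsto x atTop (𝓝 xhat)) (hΛ : Tendsto Λ atTop (𝓝 Λhat))
    (hcpos : ∀ k, 0 < c k) (hc : Tendsto c atTop atTop)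
    (hle : ∀ k, augLagrangian ζ₁ ζ₂ f G (c k) (x k) (Λ k) ≤ b) :
    Tendsto (fun k => (c k)⁻¹ • psdProj (Λ k - c k • G (x k))) atTop (𝓝 0) := by
  have hci : Tendsto (fun k => (c k)⁻¹) atTop (𝓝 0) := hc.inv_tendsto_atTop
  -- Obtained by dropping the last penalty from `L_c ≤ b` and multiplying by `2 / c`.
  have hub : Tendsto (fun k => 2 * (c k)⁻¹ * (b - f (x k)) + (c k)⁻¹ ^ 2 * ‖Λ k‖ ^ 2) atTop
      (𝓝 0) := by
    have := ((hci.const_mul 2).mul (((hf.tendsto xhat).comp hx).const_sub b)).add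
      ((hci.pow 2).mul (hΛ.norm.pow 2))
    simpa using this
  have hsq : Tendsto (fun k => ‖(c k)⁻¹ • psdProj (Λ k - c k • G (x k))‖ ^ 2) atTop (𝓝 0) := by
    refine squeeze_zero (fun k => sq_nonneg _) (fun k => ?_) hub
    have h1 := hle k
    have h2 := hcpos k
    rw [augLagrangian] at h1
    set a := ‖psdProj (Λ k - c k • G (x k))‖
    have h3 : 1 / (2 * c k) * (a ^ 2 - ‖Λ k‖ ^ 2) ≤ b - f (x k) := by
      have := sq_nonneg ‖opN ζ₁ ζ₂ G (x k) (multiplierEstimate ζ₁ ζ₂ f G (x k) - Λ k)‖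
      linarith
    have h4 := mul_le_mul_of_nonneg_left h3 (show 0 ≤ 2 * (c k)⁻¹ by positivity)
    rw [norm_smul, Real.norm_of_nonneg (by positivity)]
    have h5 : 2 * (c k)⁻¹ * (1 / (2 * c k) * (a ^ 2 - ‖Λ k‖ ^ 2)) =
        (c k)⁻¹ ^ 2 * (a ^ 2 - ‖Λ k‖ ^ 2) := by
      field_simp
    rw [h5] at h4
    linarith [mul_pow (c k)⁻¹ a 2]
  have := hsq.sqrt
  simp only [Real.sqrt_sq (norm_nonneg _), Real.sqrt_zero] at this
  exact tendsto_zero_iff_norm_tendsto_zero.2 this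

/-- `G(x k)` differs from the semidefinite matrix `c⁻¹ (A - (Λ - c G))` by `c⁻¹ (A - Λ)`, which
tends to zero. -/
theorem mem_feasibleSet_of_tendsto (hG : Continuous G)
    {x : ℕ → EuclideanSpace ℝ (Fin n)} {Λ : ℕ → SymMat m} {c : ℕ → ℝ}
    {xhat : EuclideanSpace ℝ (Fin n)} {Λhat : SymMat m}
    (hx : Tendsto x atTop (𝓝 xhat)) (hΛ : Tendsto Λ atTop (𝓝 Λhat))
    (hcpos : ∀ k, 0 < c k) (hc : Tendsto c atTop atTop)
    (hS : Tendsto (fun k => (c k)⁻¹ • psdProj (Λ k - c k • G (x k))) atTop (𝓝 0)) :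
    xhat ∈ feasibleSet G := by
  have hci : Tendsto (fun k => (c k)⁻¹) atTop (𝓝 0) := hc.inv_tendsto_atTop
  have h1 := (hS.sub (hci.smul hΛ)).add ((hG.tendsto xhat).comp hx)
  rw [zero_smul, sub_zero, zero_add] at h1
  refine isClosed_psdCone.mem_of_tendsto h1 (Eventually.of_forall fun k => ?_)
  have h2 := smul_mem_psdCone (psdProj_sub_mem (Λ k - c k • G (x k))) (inv_nonneg.2 (hcpos k).le)
  rwa [← sub_add, smul_add, smul_sub, inv_smul_smul₀ (hcpos k).ne'] at h2

end NSDP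

end

/-! ### Exactness of the augmented Lagrangian for large parameters -/

open Filter Topology NSDP NSDP.SymMat

theorem mainTheorem6 {n m : ℕ}
    (f : EuclideanSpace ℝ (Fin n) → ℝ) (G : EuclideanSpace ℝ (Fin n) → NSDP.SymMat m)
    (hf : ContDiff ℝ 2 f) (hG : ContDiff ℝ 2 G)
    (ζ₁ ζ₂ : ℝ) (hζ₁ : 0 < ζ₁) (hζ₂ : 0 < ζ₂)
    (hsol : (NSDP.globalMinimizers f G).Nonempty)
    (hnondeg : ∀ x ∈ NSDP.feasibleSet G, NSDP.IsNondegenerate G x)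
    (x : ℕ → EuclideanSpace ℝ (Fin n)) (Λ : ℕ → NSDP.SymMat m) (c : ℕ → ℝ)
    (xhat : EuclideanSpace ℝ (Fin n)) (Λhat : NSDP.SymMat m)
    (hx : Filter.Tendsto x Filter.atTop (nhds xhat))
    (hΛ : Filter.Tendsto Λ Filter.atTop (nhds Λhat))
    (hcpos : ∀ k, 0 < c k)
    (hc : Filter.Tendsto c Filter.atTop Filter.atTop)
    (hmin : ∀ k, (x k, Λ k) ∈ NSDP.augGlobalMinimizers ζ₁ ζ₂ f G (c k)) :
    ∃ K : ℕ, ∀ k ≥ K,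
      x k ∈ NSDP.globalMinimizers f G ∧ NSDP.IsKKT f G (x k) (Λ k) := by
  obtain ⟨xs, hxs, hopt⟩ := hsol
  have hle : ∀ k, augLagrangian ζ₁ ζ₂ f G (c k) (x k) (Λ k) ≤ f xs := fun k =>
    (hmin k xs _).trans (augLagrangian_multiplierEstimate_le (hcpos k) hxs)
  have hci : Tendsto (fun k => (c k)⁻¹) atTop (𝓝 0) := hc.inv_tendsto_atTop
  have hS := tendsto_inv_smul_psdProj hf.continuous hx hΛ hcpos hc hle
  have hxhat := mem_feasibleSet_of_tendsto hG.continuous hx hΛ hcpos hc hS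
  have hN : IsUnit (opN ζ₁ ζ₂ G xhat) := isUnit_opN hζ₁ hxhat (hnondeg xhat hxhat)
  have hinv : Tendsto (fun k => ‖Ring.inverse (opN ζ₁ ζ₂ G (x k))‖) atTop
      (𝓝 ‖Ring.inverse (opN ζ₁ ζ₂ G xhat)‖) := by
    have h1 : ContinuousAt Ring.inverse (opN ζ₁ ζ₂ G xhat) := by
      obtain ⟨u, hu⟩ := hN
      rw [← hu]
      exact NormedRing.inverse_continuousAt (R := SymMat m →L[ℝ] SymMat m) u
    exact Tendsto.norm (E := SymMat m →L[ℝ] SymMat m)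
      (h1.tendsto.comp (((contDiff_opN hG).continuous.tendsto xhat).comp hx))
  have hT : Tendsto (fun k => ‖fderiv ℝ (multiplierDefect ζ₁ ζ₂ f G (Λ k)) (x k)‖) atTop
      (𝓝 ‖fderiv ℝ (multiplierDefect ζ₁ ζ₂ f G Λhat) xhat‖) :=
    Tendsto.norm (E := EuclideanSpace ℝ (Fin n) →L[ℝ] SymMat m)
      (tendsto_fderiv_multiplierDefect hf hG hx hΛ)
  have hDG : Tendsto (fun k => ‖fderiv ℝ G (x k)‖) atTop (𝓝 ‖fderiv ℝ G xhat‖) :=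
    Tendsto.norm (E := EuclideanSpace ℝ (Fin n) →L[ℝ] SymMat m)
      (((hG.continuous_fderiv two_ne_zero).tendsto xhat).comp hx)
  have hJ {Z : ℕ → SymMat m} {W : SymMat m} (hZ : Tendsto Z atTop (𝓝 W)) :
      Tendsto (fun k => ‖jordanOp (Z k)‖) atTop (𝓝 ‖jordanOp W‖) :=
    Tendsto.norm (E := SymMat m →L[ℝ] SymMat m)
      ((contDiff_jordanOp.continuous.tendsto W).comp hZ)
  have hJG := hJ ((hG.continuous.tendsto xhat).comp hx)
  have hJS := hJ hS
  have hY : Tendsto (fun k => ‖(c k)⁻¹ • (psdProj (Λ k - c k • G (x k)) - Λ k)‖) atTop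
      (𝓝 0) := by
    have := (hS.sub (hci.smul hΛ)).norm
    simpa only [smul_sub, zero_smul, sub_zero, norm_zero] using this
  have hJ0 : ‖jordanOp (0 : SymMat m)‖ = 0 := by
    refine (norm_eq_zero (E := SymMat m →L[ℝ] SymMat m)).2 ?_
    ext1 Z
    rw [jordanOp_apply, jordan_comm, ← jordanOp_apply, map_zero]
    rfl
  rw [hJ0] at hJS
  -- The contraction factor tends to zero: its three summands carry `c⁻¹`, `‖jordanOp S‖` and `‖c⁻¹
  -- Y‖ ‖S‖` respectively.
  have hε := hinv.mul (((((hci.const_mul (1 / 2)).mul hinv).mul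
    (((hDG.mul hT).const_mul 2).const_add 1)).add ((hJG.mul hJS).const_mul (ζ₁ ^ 2))).add
    (((hY.mul hS.norm).const_mul (1 / 2)).const_mul (ζ₂ ^ 2)))
  simp only [mul_zero, zero_mul, add_zero, norm_zero] at hε
  have hev := (hε.eventually (gt_mem_nhds zero_lt_one)).and
    (hx.eventually (eventually_isUnit_opN hG hN))
  obtain ⟨K, hK⟩ := eventually_atTop.1 hev
  refine ⟨K, fun k hk => ?_⟩
  obtain ⟨hlt, hNk⟩ := hK k hk
  have hbound := norm_psdProj_sub_le_of_isMin hf hG (hcpos k) hNk (hmin k) rfl rfl rfl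
  have hzero : psdProj (Λ k - c k • G (x k)) = Λ k := by
    by_contra hne
    exact (mul_lt_of_lt_one_left (norm_pos_iff.2 (sub_ne_zero.2 hne)) hlt).not_ge hbound
  have hkkt := isKKT_of_psdProj_eq hf hG (hcpos k) hNk (hmin k) hzero
  refine ⟨⟨hkkt.primal_feasible, fun y hy => ?_⟩, hkkt⟩
  have h1 := hle k
  -- With `P(Λ - c G) = Λ` the middle term of `L_c` vanishes, so `f (x k)` is at most the optimal
  -- value.
  rw [augLagrangian, hzero, sub_self, mul_zero, add_zero] at h1
  have h2 := hopt y hy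
  linarith [sq_nonneg ‖opN ζ₁ ζ₂ G (x k) (multiplierEstimate ζ₁ ζ₂ f G (x k) - Λ k)‖]
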